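/- Let $k$ be an arbitrary field and let $A$ be an associative unital $k$-algebra. "Finite-dimensional" means finite-dimensional over $k$, where a left $A$-module is a $k$-vector space through $k \to A$. A left $A$-module is \emph{locally finite} (or locally finite-dimensional) if each of its finitely generated submodules is finite-dimensional. The algebra $A$ is \emph{left fully residually finite-dimensional} (left fully RFD) if every finitely generated left $A$-module $M$ is a subdirect product of finite-dimensional left $A$-modules, i.e. there are finite-dimensional left $A$-modules $N_i$ ($i \in I$) and an injective $A$-linear map $M \to \prod_{i \in I} N_i$ all of whose components $M \to N_i$ are surjective. The \emph{finite dual} $A^\circ$ is the set of $\phi \in A^* = \operatorname{Hom}_k(A,k)$ whose kernel contains a two-sided ideal of finite codimension in $A$; it is a left $A$-module through $(a\phi)(b) = \phi(ba)$. A left $A$-module $U$ is a \emph{cogenerator} in the category $A\text{-Mod}$ of left $A$-modules if the functor $\operatorname{Hom}_A(-,U)$ is faithful. The following are equivalent: (a) $A$ is left fully RFD; (b) the injective hull of every simple left $A$-module is locally finite-dimensional; (c) $A^\circ$ is a cogenerator in $A\text{-Mod}$. If moreover $A$ is left noetherian, then these properties are further equivalent to each of the following: (d) every simple left $A$-module is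 finite-dimensional, and the injective hull in $A\text{-Mod}$ of every locally finite left $A$-module is locally finite; (e) $A^\circ$ is an injective cogenerator in $A\text{-Mod}$, i.e. it is a cogenerator and an injective object of $A\text{-Mod}$. -/

import Mathlib

universe u v w w'

/-! ## Finite-dimensional and locally finite modules -/

section FiniteDimensionality

variable (k : Type u) (A : Type v) [Field k] [Ring A] [Algebra k A]

/-- A left module `M` over the `k`-algebra `A` is finite-dimensional if it is so as a `k`-vector
space, the scalar action of `k` being the one through `k → A`. -/
def IsFinDimModule (M : Type w) [AddCommGroup M] [Module A M] : Prop :=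
  Module.Finite k (RestrictScalars k A M)

/-- If a compatible `k`-action on `M` is already given, finite-dimensionality may be tested
with it. -/
theorem isFinDimModule_iff (M : Type w) [AddCommGroup M] [Module A M] [Module k M]
    [IsScalarTower k A M] : IsFinDimModule k A M ↔ Module.Finite k M := by
  let e : RestrictScalars k A M ≃ₗ[k] M :=
    { RestrictScalars.addEquiv k A M with
      map_smul' := fun c x => by
        change algebraMap k A c • RestrictScalars.addEquiv k A M x =
          c • RestrictScalars.addEquiv k A M x
        rw [algebraMap_smul] }
  exact Module.Finite.equiv_iff e

/-- A left `A`-module is locally finite(-dimensional) if each of its finitely generated submodules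
is finite-dimensional. -/
def IsLocallyFiniteModule (M : Type w) [AddCommGroup M] [Module A M] : Prop :=
  ∀ N : Submodule A M, N.FG → IsFinDimModule k A N

end FiniteDimensionality

/-! ## Subdirect products and the left fully RFD property -/

/-- `M` is a subdirect product of the family `N` of left `A`-modules: it embeds into `∏ i, N i`
in such a way that each coordinate projection `M → N i` is surjective. -/
def IsSubdirectProduct (A : Type v) [Ring A] (M : Type w) [AddCommGroup M] [Module A M]
    {ι : Type w'} (N : ι → ModuleCat.{w} A) : Prop :=
  ∃ f : M →ₗ[A] (∀ i, N i),
    Function.Injective f ∧ ∀ i, Function.Surjective fun m => f m i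

/-- `A` is left fully residually finite-dimensional: every finitely generated left `A`-module is a
subdirect product of finite-dimensional left `A`-modules. -/
def IsLeftFullyRFD (k : Type u) (A : Type v) [Field k] [Ring A] [Algebra k A] : Prop :=
  ∀ (M : Type (max u v)) [AddCommGroup M] [Module A M], Module.Finite A M →
    ∃ (ι : Type (max u v)) (N : ι → ModuleCat.{max u v} A),
      (∀ i, IsFinDimModule k A (N i)) ∧ IsSubdirectProduct A M N

/-! ## Injective hulls -/

/-- The `A`-linear map `i : M → E` exhibits `E` as an injective hull of `M`: the module `E` is
injective, and `i` is an embedding with essential image. -/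
structure IsInjectiveHull {A : Type v} [Ring A] {M E : Type w} [AddCommGroup M] [Module A M]
    [AddCommGroup E] [Module A E] (i : M →ₗ[A] E) : Prop where
  injective_module : Module.Injective A E
  injective : Function.Injective i
  essential : ∀ N : Submodule A E, N ⊓ LinearMap.range i = ⊥ → N = ⊥

/-! ## The finite dual as a left module -/

section FiniteDual

variable (k : Type u) (A : Type v) [Field k] [Ring A] [Algebra k A]

/-- The subspace `A° ⊆ A*` of the functionals whose kernel contains a two-sided ideal of finite
codimension. -/
def finiteDualSubspace : Submodule k (Module.Dual k A) where
  carrier := {φ | ∃ I : Ideal A, I.IsTwoSided ∧ Module.Finite k (A ⧸ I) ∧ ∀ x ∈ I, φ x = 0}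
  zero_mem' := ⟨⊤, inferInstance, inferInstance, fun _ _ => rfl⟩
  add_mem' := by
    rintro φ ψ ⟨I, hI, hIf, hφ⟩ ⟨J, hJ, hJf, hψ⟩
    refine ⟨I ⊓ J, ⟨fun b h => ⟨I.mul_mem_right b h.1, J.mul_mem_right b h.2⟩⟩, ?_,
      fun x hx => ?_⟩
    · let g : A →ₗ[k] (A ⧸ I) × (A ⧸ J) :=
        (I.mkQ.restrictScalars k).prod (J.mkQ.restrictScalars k)
      have hg : LinearMap.ker g = (I ⊓ J).restrictScalars k := by
        ext x
        simp [g]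
      have e : (A ⧸ (I ⊓ J).restrictScalars k) ≃ₗ[k] LinearMap.range g :=
        (Submodule.quotEquivOfEq _ _ hg.symm).trans g.quotKerEquivRange
      exact Module.Finite.equiv
        (e.symm.trans (Submodule.Quotient.restrictScalarsEquiv k (I ⊓ J)))
    · rw [LinearMap.add_apply, hφ x hx.1, hψ x hx.2, add_zero]
  smul_mem' := by
    rintro c φ ⟨I, hI, hIf, hφ⟩
    exact ⟨I, hI, hIf, fun x hx => by rw [LinearMap.smul_apply, hφ x hx, smul_zero]⟩

/-- The finite dual `A°` of the `k`-algebra `A`. -/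
def FiniteDual : Type (max u v) := finiteDualSubspace k A

noncomputable instance : AddCommGroup (FiniteDual k A) :=
  inferInstanceAs (AddCommGroup (finiteDualSubspace k A))

/-- The usual left `A`-action on `A°`: `(a • φ) b = φ (b * a)`. -/
noncomputable instance : Module A (FiniteDual k A) where
  smul a φ := ⟨φ.1.comp (LinearMap.mulRight k a), by
    obtain ⟨φ, I, hI, hIf, hφ⟩ := φ
    exact ⟨I, hI, hIf, fun x hx => hφ _ (I.mul_mem_right a hx)⟩⟩
  one_smul φ := Subtype.ext (LinearMap.ext fun b => congrArg φ.1 (mul_one b))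
  mul_smul a a' φ := Subtype.ext (LinearMap.ext fun b => congrArg φ.1 (mul_assoc b a a').symm)
  smul_zero _ := rfl
  smul_add _ _ _ := rfl
  add_smul a a' φ := Subtype.ext (LinearMap.ext fun b =>
    (congrArg φ.1 (mul_add b a a')).trans (map_add φ.1 _ _))
  zero_smul φ := Subtype.ext (LinearMap.ext fun b =>
    (congrArg φ.1 (mul_zero b)).trans (map_zero φ.1))

theorem FiniteDual.smul_apply (a : A) (φ : FiniteDual k A) (b : A) :
    (a • φ).1 b = φ.1 (b * a) := rfl

end FiniteDual

/-!
A functional on a locally finite module `M` is the same as an `A`-linear map `M → A°`: to `l`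
corresponds `m ↦ (b ↦ l (b • m))`, where `A m` is annihilated by a two-sided ideal of finite
codimension. Hence `A°` is injective relative to locally finite modules and separates their points.

(a) ⇒ (b), (d): let `F` be essential in a finitely generated module `N`. If `F` is artinian and `N`
is residually finite-dimensional, then finitely many submodules of finite codimension suffice to cut
`F` down to zero; their intersection is then zero by essentiality, so `N` is finite-dimensional.
(b) ⇒ (c): every nonzero element survives in the injective hull of some simple module, and from
there in `A°`. (c) ⇒ (a): `A°` is locally finite, so finitely generated modules that it separates
are residually finite-dimensional. (d) ⇒ (e): `A°` is a retract of its locally finite hull.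
-/

section EssentialExtension

/-- In the lattice of submodules: `b` is an essential extension of `a`, i.e. `a ≤ b` and every
nonzero part of `b` meets `a`. It is stated in a lattice because Zorn's lemma is applied there. -/
def IsEssentialExtension {α : Type*} [Lattice α] [OrderBot α] (a b : α) : Prop :=
  a ≤ b ∧ ∀ c ≤ b, Disjoint c a → c = ⊥

theorem IsEssentialExtension.refl {α : Type*} [Lattice α] [OrderBot α] (a : α) :
    IsEssentialExtension a a :=
  ⟨le_rfl, fun _ hca hdisj => hdisj.eq_bot_of_le hca⟩

theorem IsEssentialExtension.trans {α : Type*} [Lattice α] [OrderBot α] {a b c : α}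
    (hab : IsEssentialExtension a b) (hbc : IsEssentialExtension b c) :
    IsEssentialExtension a c :=
  ⟨hab.1.trans hbc.1, fun d hdc hda => hbc.2 d hdc <|
    disjoint_iff.2 <| hab.2 _ inf_le_right <| hda.mono_left inf_le_left⟩

variable {α : Type*} [CompleteLattice α] [IsCompactlyGenerated α]

theorem IsEssentialExtension.sSup {a : α} {s : Set α} (hs : s.Nonempty)
    (hdir : DirectedOn (· ≤ ·) s) (h : ∀ b ∈ s, IsEssentialExtension a b) :
    IsEssentialExtension a (sSup s) := by
  obtain ⟨b, hb⟩ := hs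
  refine ⟨(h b hb).1.trans (le_sSup hb), fun c hc hca => ?_⟩
  have hdisj : Disjoint c (SupSet.sSup s) := hdir.disjoint_sSup_right.2 fun x hx =>
    disjoint_iff.2 <| (h x hx).2 _ inf_le_right <| hca.mono_left inf_le_left
  exact hdisj.eq_bot_of_le hc

theorem exists_maximal_isEssentialExtension (a : α) :
    ∃ b, Maximal (IsEssentialExtension a) b := by
  obtain ⟨b, -, hb⟩ := zorn_le_nonempty₀ {b | IsEssentialExtension a b}
    (fun c hc hchain b hb => ⟨sSup c, .sSup ⟨b, hb⟩ hchain.directedOn hc, fun _ => le_sSup⟩)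
    a (.refl a)
  exact ⟨b, hb⟩

theorem exists_maximal_disjoint (a : α) : ∃ b, Maximal (Disjoint a) b := by
  obtain ⟨b, -, hb⟩ := zorn_le_nonempty₀ {b | Disjoint a b}
    (fun c hc hchain _ _ =>
      ⟨sSup c, hchain.directedOn.disjoint_sSup_right.2 hc, fun _ => le_sSup⟩) ⊥ disjoint_bot_right
  exact ⟨b, hb⟩

end EssentialExtension

section InjectiveHull

variable {A : Type v} [Ring A]

theorem IsEssentialExtension.comap {M : Type w} {N : Type w'} [AddCommGroup M] [Module A M]
    [AddCommGroup N] [Module A N] {F G : Submodule A N} (h : IsEssentialExtension F G)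
    {f : M →ₗ[A] N} (hf : Function.Injective f) :
    IsEssentialExtension (F.comap f) (G.comap f) := by
  refine ⟨Submodule.comap_mono h.1, fun L hL hdisj => ?_⟩
  have hmap : L.map f = ⊥ := by
    refine h.2 _ (Submodule.map_le_iff_le_comap.2 hL) ?_
    rw [disjoint_iff, Submodule.map_inf_eq_map_inf_comap, hdisj.eq_bot, Submodule.map_bot]
  exact Submodule.map_injective_of_injective hf (hmap.trans (Submodule.map_bot f).symm)

theorem submoduleComap_injective {M : Type w} {N : Type w'} [AddCommGroup M] [Module A M]
    [AddCommGroup N] [Module A N] {f : M →ₗ[A] N} (hf : Function.Injective f) (F : Submodule A N) :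
    Function.Injective (f.submoduleComap F) := fun x _ (hxy : f.submoduleComap F x = _) =>
  Subtype.ext (hf (congrArg Subtype.val hxy))

theorem IsInjectiveHull.isEssentialExtension_range {M E : Type w} [AddCommGroup M] [Module A M]
    [AddCommGroup E] [Module A E] {i : M →ₗ[A] E} (hi : IsInjectiveHull i) :
    IsEssentialExtension (LinearMap.range i) ⊤ :=
  ⟨le_top, fun L _ hL => hi.essential L hL.eq_bot⟩

theorem injective_of_retract {Q E : Type w} [AddCommGroup Q] [Module A Q] [AddCommGroup E]
    [Module A E] (hQ : Module.Injective A Q) (i : E →ₗ[A] Q) (r : Q →ₗ[A] E)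
    (hr : r ∘ₗ i = LinearMap.id) : Module.Injective A E where
  out X Y _ _ _ _ f hf g := by
    obtain ⟨h, hh⟩ := hQ.out f hf (i ∘ₗ g)
    refine ⟨r ∘ₗ h, fun x => ?_⟩
    rw [LinearMap.comp_apply, hh]
    exact LinearMap.congr_fun hr (g x)

/-- A submodule of the range disjoint from `E` pulls back along `r` to a submodule that is disjoint
from `E` and contains `C`, hence equals `C` by maximality. -/
theorem isEssentialExtension_range_of_maximal_disjoint {Q : Type w} [AddCommGroup Q] [Module A Q]
    {E C : Submodule A Q} (hC : Maximal (Disjoint E) C) {r : Q →ₗ[A] Q}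
    (hrE : ∀ x ∈ E, r x = x) (hrC : C ≤ LinearMap.ker r) :
    IsEssentialExtension E (LinearMap.range r) := by
  refine ⟨fun x hx => ⟨x, hrE x hx⟩, fun L hL hLE => ?_⟩
  have hdisj : Disjoint E (L.comap r) := Submodule.disjoint_def.2 fun x hxE hxL =>
    Submodule.disjoint_def.1 hLE x (hrE x hxE ▸ hxL) hxE
  have hle : L.comap r ≤ LinearMap.ker r :=
    (hC.le_of_ge hdisj (hrC.trans (LinearMap.ker_le_comap r))).trans hrC
  rw [← Submodule.map_comap_eq_of_le hL, ← le_bot_iff]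
  exact Submodule.map_le_iff_le_comap.2 hle

theorem exists_retraction_of_maximal_isEssentialExtension {Q : Type w} [AddCommGroup Q]
    [Module A Q] (hQ : Module.Injective A Q) {M E : Submodule A Q}
    (hE : Maximal (IsEssentialExtension M) E) :
    ∃ r : Q →ₗ[A] E, r ∘ₗ E.subtype = LinearMap.id := by
  obtain ⟨C, hC⟩ := exists_maximal_disjoint E
  have hinj : Function.Injective (C.mkQ ∘ₗ E.subtype) := by
    rw [← LinearMap.ker_eq_bot, LinearMap.ker_comp, Submodule.ker_mkQ]
    exact Submodule.disjoint_iff_comap_eq_bot.1 hC.prop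
  obtain ⟨g, hg⟩ := hQ.out _ hinj E.subtype
  have hess : IsEssentialExtension E (LinearMap.range (g ∘ₗ C.mkQ)) :=
    isEssentialExtension_range_of_maximal_disjoint hC (fun x hx => hg ⟨x, hx⟩) fun x hx => by
      simp [(Submodule.Quotient.mk_eq_zero C).2 hx]
  have hrange : LinearMap.range (g ∘ₗ C.mkQ) ≤ E := hE.le_of_ge (hE.prop.trans hess) hess.1
  exact ⟨(g ∘ₗ C.mkQ).codRestrict E fun x => hrange ⟨x, rfl⟩,
    LinearMap.ext fun x => Subtype.ext (hg x)⟩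

open CategoryTheory in
theorem exists_isInjectiveHull [Small.{w} A] (M : Type w) [AddCommGroup M] [Module A M] :
    ∃ (E : ModuleCat.{w} A) (i : M →ₗ[A] E), IsInjectiveHull i := by
  obtain ⟨⟨Q, hQ, j, hj⟩⟩ := EnoughInjectives.presentation (ModuleCat.of A M)
  have hQ : Module.Injective A Q := Module.injective_module_of_injective_object A Q
  obtain ⟨E, hE⟩ := exists_maximal_isEssentialExtension (LinearMap.range j.hom)
  obtain ⟨r, hr⟩ := exists_retraction_of_maximal_isEssentialExtension hQ hE
  have hrange : ∀ m, j.hom m ∈ E := fun m => hE.prop.1 ⟨m, rfl⟩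
  have hess := hE.prop.comap E.injective_subtype
  refine ⟨ModuleCat.of A E, j.hom.codRestrict E hrange, injective_of_retract hQ _ r hr,
    fun x y hxy => (ModuleCat.mono_iff_injective j).1 hj (congrArg Subtype.val hxy),
    fun L hL => hess.2 L (by simp) (disjoint_iff.2 ?_)⟩
  rwa [← LinearMap.range_codRestrict E j.hom hrange]

theorem exists_linearMap_isInjectiveHull_ne_zero [Small.{w} A] {M : Type w} [AddCommGroup M]
    [Module A M] {m : M} (hm : m ≠ 0) :
    ∃ (V E : ModuleCat.{w} A) (i : V →ₗ[A] E) (f : M →ₗ[A] E),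
      IsSimpleModule A V ∧ IsInjectiveHull i ∧ f m ≠ 0 := by
  let C := Submodule.span A {m}
  let m' : C := ⟨m, Submodule.mem_span_singleton_self m⟩
  have : Nontrivial C := ⟨m', 0, fun h => hm (congrArg Subtype.val h)⟩
  have : Module.Finite A C := Module.Finite.span_singleton A m
  obtain ⟨L, hL⟩ := IsCoatomic.exists_coatom (Submodule A C)
  have hm'L : m' ∉ L := fun h => hL.1 <| eq_top_iff.2 fun x _ => by
    obtain ⟨a, ha⟩ := Submodule.mem_span_singleton.1 x.2
    exact (Subtype.ext ha : a • m' = x) ▸ L.smul_mem a h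
  obtain ⟨E, i, hi⟩ := exists_isInjectiveHull (A := A) (C ⧸ L)
  obtain ⟨f, hf⟩ := hi.injective_module.out C.subtype C.injective_subtype (i ∘ₗ L.mkQ)
  refine ⟨ModuleCat.of A (C ⧸ L), E, i, f, isSimpleModule_iff_isCoatom.2 hL, hi, fun h0 => hm'L ?_⟩
  rw [← Submodule.Quotient.mk_eq_zero]
  exact (map_eq_zero_iff i hi.injective).1 ((hf m').symm.trans h0)

end InjectiveHull

section FiniteDimensionality

variable {k : Type u} {A : Type v} [Field k] [Ring A] [Algebra k A]
variable {M : Type w} [AddCommGroup M] [Module A M] {N : Type w'} [AddCommGroup N] [Module A N]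

/-- `IsScalarTower.of_compHom` is stated for `MulAction.compHom`, which instance search does not
identify with `Module.compHom`. -/
theorem isScalarTower_compHom (k : Type u) (A : Type v) [Field k] [Ring A] [Algebra k A]
    (M : Type w) [AddCommGroup M] [Module A M] :
    letI := Module.compHom M (algebraMap k A)
    IsScalarTower k A M :=
  IsScalarTower.of_compHom k A M

theorem IsFinDimModule.of_injective (f : M →ₗ[A] N) (hf : Function.Injective f)
    (hN : IsFinDimModule k A N) : IsFinDimModule k A M := by
  let := Module.compHom M (algebraMap k A)
  let := Module.compHom N (algebraMap k A)
  have := isScalarTower_compHom k A M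
  have := isScalarTower_compHom k A N
  rw [isFinDimModule_iff] at hN ⊢
  exact Module.Finite.of_injective (f.restrictScalars k) hf

theorem IsFinDimModule.of_surjective (f : M →ₗ[A] N) (hf : Function.Surjective f)
    (hM : IsFinDimModule k A M) : IsFinDimModule k A N := by
  let := Module.compHom M (algebraMap k A)
  let := Module.compHom N (algebraMap k A)
  have := isScalarTower_compHom k A M
  have := isScalarTower_compHom k A N
  rw [isFinDimModule_iff] at hM ⊢
  exact Module.Finite.of_surjective (f.restrictScalars k) hf

theorem IsFinDimModule.of_subsingleton [Subsingleton M] : IsFinDimModule k A M :=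
  have : Subsingleton (RestrictScalars k A M) := ‹Subsingleton M›
  inferInstanceAs (Module.Finite k (RestrictScalars k A M))

theorem IsFinDimModule.prod (hM : IsFinDimModule k A M) (hN : IsFinDimModule k A N) :
    IsFinDimModule k A (M × N) := by
  let := Module.compHom M (algebraMap k A)
  let := Module.compHom N (algebraMap k A)
  have := isScalarTower_compHom k A M
  have := isScalarTower_compHom k A N
  rw [isFinDimModule_iff] at hM hN ⊢
  infer_instance

theorem IsFinDimModule.quotient_ker (f : M →ₗ[A] N) (hN : IsFinDimModule k A N) :
    IsFinDimModule k A (M ⧸ LinearMap.ker f) :=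
  hN.of_injective ((LinearMap.ker f).liftQ f le_rfl)
    (LinearMap.ker_eq_bot.1 (Submodule.ker_liftQ_eq_bot _ _ _ le_rfl))

theorem IsFinDimModule.quotient_inf {L L' : Submodule A M} (hL : IsFinDimModule k A (M ⧸ L))
    (hL' : IsFinDimModule k A (M ⧸ L')) : IsFinDimModule k A (M ⧸ L ⊓ L') := by
  have hker : LinearMap.ker (L.mkQ.prod L'.mkQ) = L ⊓ L' := by
    rw [LinearMap.ker_prod, Submodule.ker_mkQ, Submodule.ker_mkQ]
  exact hker ▸ (hL.prod hL').quotient_ker _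

theorem IsFinDimModule.isArtinian (hM : IsFinDimModule k A M) : IsArtinian A M := by
  let := Module.compHom M (algebraMap k A)
  have := isScalarTower_compHom k A M
  rw [isFinDimModule_iff] at hM
  exact isArtinian_of_tower k inferInstance

theorem IsFinDimModule.quotient_annihilator (hM : IsFinDimModule k A M) :
    IsFinDimModule k A (A ⧸ Module.annihilator A M) := by
  let := Module.compHom M (algebraMap k A)
  have := isScalarTower_compHom k A M
  rw [isFinDimModule_iff] at hM
  have hEnd : IsFinDimModule k A (Module.End k M) := (isFinDimModule_iff k A _).2 inferInstance
  have hker : LinearMap.ker (LinearMap.toSpanSingleton A (Module.End k M) 1) =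
      Module.annihilator A M := by
    ext a
    simp [Module.mem_annihilator, LinearMap.ext_iff]
  exact hker ▸ hEnd.quotient_ker _

theorem IsFinDimModule.isLocallyFiniteModule (hM : IsFinDimModule k A M) :
    IsLocallyFiniteModule k A M :=
  fun L _ => hM.of_injective L.subtype L.injective_subtype

theorem IsLocallyFiniteModule.of_injective (f : M →ₗ[A] N) (hf : Function.Injective f)
    (hN : IsLocallyFiniteModule k A N) : IsLocallyFiniteModule k A M := fun L hL =>
  (hN (L.map f) (hL.map f)).of_injective (Submodule.equivMapOfInjective f hf L).toLinearMap
    (Submodule.equivMapOfInjective f hf L).injective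

theorem IsLocallyFiniteModule.isFinDimModule (hM : IsLocallyFiniteModule k A M)
    [Module.Finite A M] : IsFinDimModule k A M :=
  (hM ⊤ Module.Finite.fg_top).of_injective Submodule.topEquiv.symm.toLinearMap
    Submodule.topEquiv.symm.injective

theorem isLocallyFiniteModule_of_span_singleton
    (h : ∀ x : M, IsFinDimModule k A (Submodule.span A {x})) : IsLocallyFiniteModule k A M := by
  intro L hL
  induction L, hL using Submodule.fg_induction with
  | singleton x => exact h x
  | sup L₁ L₂ _ _ h₁ h₂ =>
    refine (h₁.prod h₂).of_surjective
      ((Submodule.inclusion le_sup_left).coprod (Submodule.inclusion le_sup_right)) ?_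
    rintro ⟨x, hx⟩
    obtain ⟨y, hy, z, hz, rfl⟩ := Submodule.mem_sup.1 hx
    exact ⟨(⟨y, hy⟩, ⟨z, hz⟩), rfl⟩

end FiniteDimensionality

section ResidualFiniteness

/-- The module `M` is residually finite-dimensional: its submodules of finite codimension intersect
in zero. This is the intrinsic form of being a subdirect product of finite-dimensional modules. -/
def IsResiduallyFinDim (k : Type u) (A : Type v) [Field k] [Ring A] [Algebra k A] (M : Type w)
    [AddCommGroup M] [Module A M] : Prop :=
  ∀ m : M, m ≠ 0 → ∃ L : Submodule A M, IsFinDimModule k A (M ⧸ L) ∧ m ∉ L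

variable {k : Type u} {A : Type v} [Field k] [Ring A] [Algebra k A]
variable {M : Type w} [AddCommGroup M] [Module A M]

theorem IsSubdirectProduct.isResiduallyFinDim {ι : Type w'} {N : ι → ModuleCat.{w} A}
    (h : IsSubdirectProduct A M N) (hN : ∀ i, IsFinDimModule k A (N i)) :
    IsResiduallyFinDim k A M := by
  obtain ⟨f, hf, -⟩ := h
  intro m hm
  obtain ⟨i, hi⟩ := Function.ne_iff.1 ((map_ne_zero_iff f hf).2 hm)
  exact ⟨LinearMap.ker (LinearMap.proj i ∘ₗ f), (hN i).quotient_ker _, hi⟩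

theorem IsResiduallyFinDim.isSubdirectProduct (h : IsResiduallyFinDim k A M) :
    IsSubdirectProduct A M
      fun L : {L : Submodule A M // IsFinDimModule k A (M ⧸ L)} => ModuleCat.of A (M ⧸ L.1) := by
  refine ⟨LinearMap.pi fun L => L.1.mkQ, (injective_iff_map_eq_zero _).2 fun m hm => ?_,
    fun L => L.1.mkQ_surjective⟩
  by_contra hm0
  obtain ⟨L, hL, hmL⟩ := h m hm0
  exact hmL ((Submodule.Quotient.mk_eq_zero L).1 (congrFun hm ⟨L, hL⟩))

theorem isLeftFullyRFD_iff_isResiduallyFinDim : IsLeftFullyRFD k A ↔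
    ∀ (M : Type (max u v)) [AddCommGroup M] [Module A M], Module.Finite A M →
      IsResiduallyFinDim k A M := by
  refine ⟨fun h M _ _ hM => ?_, fun h M _ _ hM => ⟨_, _, Subtype.prop, (h M hM).isSubdirectProduct⟩⟩
  obtain ⟨ι, N, hN, hMN⟩ := h M hM
  exact hMN.isResiduallyFinDim hN

theorem IsResiduallyFinDim.exists_disjoint (h : IsResiduallyFinDim k A M) (F : Submodule A M)
    [IsArtinian A F] : ∃ L : Submodule A M, IsFinDimModule k A (M ⧸ L) ∧ Disjoint L F := by
  obtain ⟨L, hL, hmin⟩ := exists_minimalFor_of_wellFoundedLT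
    (fun L : Submodule A M => IsFinDimModule k A (M ⧸ L)) (fun L => L.comap F.subtype)
    ⟨⊤, .of_subsingleton⟩
  refine ⟨L, hL, Submodule.disjoint_def.2 fun x hxL hxF => ?_⟩
  by_contra hx
  obtain ⟨L', hL', hxL'⟩ := h x hx
  have hle : L.comap F.subtype ≤ (L ⊓ L').comap F.subtype :=
    hmin (hL.quotient_inf hL') (Submodule.comap_mono inf_le_left)
  exact hxL' (hle (show (⟨x, hxF⟩ : F) ∈ L.comap F.subtype from hxL)).2

theorem IsResiduallyFinDim.isFinDimModule_of_isEssentialExtension (h : IsResiduallyFinDim k A M)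
    {F : Submodule A M} [IsArtinian A F] (hF : IsEssentialExtension F ⊤) :
    IsFinDimModule k A M := by
  obtain ⟨L, hL, hdisj⟩ := h.exists_disjoint F
  obtain rfl : L = ⊥ := hF.2 L le_top hdisj
  exact hL.of_injective (Submodule.mkQ ⊥) (LinearMap.ker_eq_bot.1 (Submodule.ker_mkQ _))

theorem IsLeftFullyRFD.isFinDimModule_of_isSimpleModule (h : IsLeftFullyRFD k A)
    (V : Type (max u v)) [AddCommGroup V] [Module A V] [IsSimpleModule A V] :
    IsFinDimModule k A V :=
  (isLeftFullyRFD_iff_isResiduallyFinDim.1 h V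
    inferInstance).isFinDimModule_of_isEssentialExtension (.refl ⊤)

variable {E : Type (max u v)} [AddCommGroup E] [Module A E] {F : Submodule A E}

theorem IsLeftFullyRFD.isFinDimModule_of_fg (h : IsLeftFullyRFD k A)
    (hF : IsEssentialExtension F ⊤) {N : Submodule A E} (hN : N.FG)
    [IsArtinian A (F.comap N.subtype)] : IsFinDimModule k A N :=
  (isLeftFullyRFD_iff_isResiduallyFinDim.1 h N
    (.of_fg hN)).isFinDimModule_of_isEssentialExtension (hF.comap N.injective_subtype)

theorem IsLeftFullyRFD.isLocallyFiniteModule_of_isArtinian (h : IsLeftFullyRFD k A)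
    (hF : IsEssentialExtension F ⊤) [IsArtinian A F] : IsLocallyFiniteModule k A E := fun N hN =>
  have : IsArtinian A (F.comap N.subtype) := isArtinian_of_injective (N.subtype.submoduleComap F)
    (submoduleComap_injective N.injective_subtype F)
  h.isFinDimModule_of_fg hF hN

theorem IsLeftFullyRFD.isLocallyFiniteModule_of_isNoetherianRing [IsNoetherianRing A]
    (h : IsLeftFullyRFD k A) (hF : IsEssentialExtension F ⊤) (hFfin : IsLocallyFiniteModule k A F) :
    IsLocallyFiniteModule k A E := by
  intro N hN
  have : Module.Finite A N := .of_fg hN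
  have hfin : IsLocallyFiniteModule k A (F.comap N.subtype) :=
    hFfin.of_injective (N.subtype.submoduleComap F)
      (submoduleComap_injective N.injective_subtype F)
  have : IsArtinian A (F.comap N.subtype) := hfin.isFinDimModule.isArtinian
  exact h.isFinDimModule_of_fg hF hN

end ResidualFiniteness

section FiniteDual

variable {k : Type u} {A : Type v} [Field k] [Ring A] [Algebra k A]

theorem FiniteDual.ext {φ ψ : FiniteDual k A} (h : ∀ b, φ.1 b = ψ.1 b) : φ = ψ :=
  Subtype.ext (LinearMap.ext h)

theorem FiniteDual.isLocallyFiniteModule : IsLocallyFiniteModule k A (FiniteDual k A) := by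
  refine isLocallyFiniteModule_of_span_singleton fun φ => ?_
  obtain ⟨I, _, hIfin, hφ⟩ := φ.2
  have hker : I ≤ LinearMap.ker (LinearMap.toSpanSingleton A (FiniteDual k A) φ) := fun a ha =>
    FiniteDual.ext fun b => hφ _ (I.mul_mem_left b ha)
  have hfin : IsFinDimModule k A (A ⧸ I) := (isFinDimModule_iff k A _).2 hIfin
  rw [← LinearMap.range_toSpanSingleton, ← Submodule.range_liftQ I _ hker]
  exact hfin.of_surjective _ (LinearMap.surjective_rangeRestrict _)

noncomputable instance : Module k (FiniteDual k A) :=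
  inferInstanceAs (Module k (finiteDualSubspace k A))

instance : IsScalarTower k A (FiniteDual k A) where
  smul_assoc c a φ := FiniteDual.ext fun b =>
    (congrArg φ.1 (mul_smul_comm c b a)).trans (map_smul φ.1 c (b * a))

variable (k A) in
/-- Evaluation at `1` on `A°`: composition with it turns an `A`-linear map `M → A°` into the
functional on `M` that determines it. -/
noncomputable def FiniteDual.evalOne : FiniteDual k A →ₗ[k] k :=
  (LinearMap.applyₗ (1 : A)).domRestrict (finiteDualSubspace k A)

/-- The `A`-linear map from a locally finite module to `A°` attached to a linear functional. -/
noncomputable def FiniteDual.lift {M : Type w} [AddCommGroup M] [Module A M] [Module k M]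
    [IsScalarTower k A M] (hM : IsLocallyFiniteModule k A M) (l : M →ₗ[k] k) :
    M →ₗ[A] FiniteDual k A where
  toFun m := ⟨l ∘ₗ (LinearMap.toSpanSingleton A M m).restrictScalars k,
    Module.annihilator A (Submodule.span A {m}), inferInstance,
    (isFinDimModule_iff k A _).1 (hM _ (Submodule.fg_span_singleton m)).quotient_annihilator,
    fun a ha => by
      have : a • m = 0 := congrArg Subtype.val
        (Module.mem_annihilator.1 ha ⟨m, Submodule.mem_span_singleton_self m⟩)
      simp [this]⟩
  map_add' m n := FiniteDual.ext fun b => (congrArg l (smul_add b m n)).trans (map_add l _ _)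
  map_smul' a m := FiniteDual.ext fun b => congrArg l (smul_smul b a m)

theorem FiniteDual.lift_apply {M : Type w} [AddCommGroup M] [Module A M] [Module k M]
    [IsScalarTower k A M] (hM : IsLocallyFiniteModule k A M) (l : M →ₗ[k] k) (m : M) (b : A) :
    (FiniteDual.lift hM l m).1 b = l (b • m) := rfl

theorem FiniteDual.exists_linearMap_ne_zero {M : Type w} [AddCommGroup M] [Module A M]
    (hM : IsLocallyFiniteModule k A M) {m : M} (hm : m ≠ 0) :
    ∃ f : M →ₗ[A] FiniteDual k A, f m ≠ 0 := by
  let := Module.compHom M (algebraMap k A)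
  have := isScalarTower_compHom k A M
  obtain ⟨l, hl⟩ := Module.Projective.exists_dual_ne_zero k hm
  refine ⟨FiniteDual.lift hM l, fun h0 => hl ?_⟩
  have hlm : (FiniteDual.lift hM l m).1 1 = 0 := by rw [h0]; rfl
  rwa [FiniteDual.lift_apply, one_smul] at hlm

theorem FiniteDual.exists_comp_eq_of_injective {M : Type w} {N : Type w'} [AddCommGroup M]
    [Module A M] [AddCommGroup N] [Module A N] (hN : IsLocallyFiniteModule k A N)
    (f : M →ₗ[A] N) (hf : Function.Injective f) (g : M →ₗ[A] FiniteDual k A) :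
    ∃ h : N →ₗ[A] FiniteDual k A, h ∘ₗ f = g := by
  let := Module.compHom M (algebraMap k A)
  have := isScalarTower_compHom k A M
  let := Module.compHom N (algebraMap k A)
  have := isScalarTower_compHom k A N
  obtain ⟨p, hp⟩ := (f.restrictScalars k).exists_leftInverse_of_injective
    (LinearMap.ker_eq_bot.2 hf)
  refine ⟨FiniteDual.lift hN (evalOne k A ∘ₗ g.restrictScalars k ∘ₗ p),
    LinearMap.ext fun m => FiniteDual.ext fun b => ?_⟩
  calc evalOne k A (g (p (b • f m)))
      = evalOne k A (g (p (f (b • m)))) := by rw [f.map_smul]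
    _ = evalOne k A (g (b • m)) :=
        congrArg (fun x => evalOne k A (g x)) (LinearMap.congr_fun hp (b • m))
    _ = evalOne k A (b • g m) := by rw [g.map_smul]
    _ = (g m).1 b := congrArg (g m).1 (one_mul b)

theorem FiniteDual.injective_of_embedding {E : Type (max u v)} [AddCommGroup E] [Module A E]
    (hE : Module.Injective A E) (hEfin : IsLocallyFiniteModule k A E)
    (i : FiniteDual k A →ₗ[A] E) (hi : Function.Injective i) :
    Module.Injective A (FiniteDual k A) := by
  obtain ⟨r, hr⟩ := FiniteDual.exists_comp_eq_of_injective hEfin i hi LinearMap.id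
  exact injective_of_retract hE i r hr

end FiniteDual

section Cogenerator

open CategoryTheory

theorem isCoseparator_moduleCat_iff {A : Type v} [Ring A] (U : Type w) [AddCommGroup U]
    [Module A U] : IsCoseparator (ModuleCat.of A U) ↔
      ∀ (M : Type w) [AddCommGroup M] [Module A M] (m : M), m ≠ 0 →
        ∃ f : M →ₗ[A] U, f m ≠ 0 := by
  rw [Preadditive.isCoseparator_iff]
  refine ⟨fun h M _ _ m hm => ?_, fun h X Y f hf => ?_⟩
  · by_contra! hkill
    have hzero := h (ModuleCat.ofHom (Submodule.span A {m}).subtype) fun g => by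
      ext ⟨x, hx⟩
      obtain ⟨a, rfl⟩ := Submodule.mem_span_singleton.1 hx
      simp [hkill g.hom]
    exact hm (LinearMap.congr_fun (ModuleCat.hom_ext_iff.1 hzero)
      ⟨m, Submodule.mem_span_singleton_self m⟩)
  · ext x
    by_contra hne
    obtain ⟨p, hp⟩ := h Y (f.hom x) hne
    exact hp (LinearMap.congr_fun (ModuleCat.hom_ext_iff.1 (hf (ModuleCat.ofHom p))) x)

/-- Condition (b): the injective hulls of the simple left `A`-modules are locally finite. -/
def HasLocallyFiniteSimpleHulls (k : Type u) (A : Type v) [Field k] [Ring A] [Algebra k A] : Prop :=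
  ∀ (V E : Type (max u v)) [AddCommGroup V] [Module A V] [AddCommGroup E] [Module A E]
    (i : V →ₗ[A] E), IsSimpleModule A V → IsInjectiveHull i → IsLocallyFiniteModule k A E

variable {k : Type u} {A : Type v} [Field k] [Ring A] [Algebra k A]

theorem IsLeftFullyRFD.hasLocallyFiniteSimpleHulls (h : IsLeftFullyRFD k A) :
    HasLocallyFiniteSimpleHulls k A := fun _ _ _ _ _ _ _ _ hi =>
  h.isLocallyFiniteModule_of_isArtinian hi.isEssentialExtension_range

theorem HasLocallyFiniteSimpleHulls.isCoseparator_finiteDual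
    (h : HasLocallyFiniteSimpleHulls k A) : IsCoseparator (ModuleCat.of A (FiniteDual k A)) := by
  refine (isCoseparator_moduleCat_iff _).2 fun M _ _ m hm => ?_
  obtain ⟨V, E, i, f, hV, hi, hf⟩ := exists_linearMap_isInjectiveHull_ne_zero (A := A) hm
  obtain ⟨g, hg⟩ := FiniteDual.exists_linearMap_ne_zero (h V E i hV hi) hf
  exact ⟨g ∘ₗ f, hg⟩

theorem isLeftFullyRFD_of_isCoseparator_finiteDual
    (h : IsCoseparator (ModuleCat.of A (FiniteDual k A))) : IsLeftFullyRFD k A := by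
  refine isLeftFullyRFD_iff_isResiduallyFinDim.2 fun M _ _ hM m hm => ?_
  obtain ⟨f, hf⟩ := (isCoseparator_moduleCat_iff _).1 h M m hm
  have hrange : IsFinDimModule k A (LinearMap.range f) :=
    FiniteDual.isLocallyFiniteModule _ (Module.Finite.iff_fg.1 inferInstance)
  exact ⟨LinearMap.ker f.rangeRestrict, hrange.quotient_ker _, by simpa using hf⟩

variable (k A) in
theorem isLeftFullyRFD_tfae : List.TFAE [IsLeftFullyRFD k A, HasLocallyFiniteSimpleHulls k A,
    IsCoseparator (ModuleCat.of A (FiniteDual k A))] := by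
  tfae_have 1 → 2 := IsLeftFullyRFD.hasLocallyFiniteSimpleHulls
  tfae_have 2 → 3 := HasLocallyFiniteSimpleHulls.isCoseparator_finiteDual
  tfae_have 3 → 1 := isLeftFullyRFD_of_isCoseparator_finiteDual
  tfae_finish

end Cogenerator

theorem mainTheorem4 (k : Type u) (A : Type v) [Field k] [Ring A] [Algebra k A] :
    List.TFAE [
      -- (a) `A` is left fully RFD
      IsLeftFullyRFD k A,
      -- (b) the injective hull of every simple left module is locally finite-dimensional
      ∀ (V E : Type (max u v)) [AddCommGroup V] [Module A V] [AddCommGroup E] [Module A E]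
        (i : V →ₗ[A] E), IsSimpleModule A V → IsInjectiveHull i → IsLocallyFiniteModule k A E,
      -- (c) `A°` is a cogenerator
      CategoryTheory.IsCoseparator (ModuleCat.of A (FiniteDual k A))] ∧
    (IsNoetherianRing A → List.TFAE [
      IsLeftFullyRFD k A,
      ∀ (V E : Type (max u v)) [AddCommGroup V] [Module A V] [AddCommGroup E] [Module A E]
        (i : V →ₗ[A] E), IsSimpleModule A V → IsInjectiveHull i → IsLocallyFiniteModule k A E,
      CategoryTheory.IsCoseparator (ModuleCat.of A (FiniteDual k A)),
      -- (d) simple left modules are finite-dimensional, and the locally finite modules are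
      -- closed under injective hulls
      (∀ (V : Type (max u v)) [AddCommGroup V] [Module A V],
        IsSimpleModule A V → IsFinDimModule k A V) ∧
      (∀ (M E : Type (max u v)) [AddCommGroup M] [Module A M] [AddCommGroup E] [Module A E]
        (i : M →ₗ[A] E), IsLocallyFiniteModule k A M → IsInjectiveHull i →
          IsLocallyFiniteModule k A E),
      -- (e) `A°` is an injective cogenerator
      CategoryTheory.Injective (ModuleCat.of A (FiniteDual k A)) ∧
      CategoryTheory.IsCoseparator (ModuleCat.of A (FiniteDual k A))]) := by
  have abc := isLeftFullyRFD_tfae k A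
  refine ⟨abc, fun _ => ?_⟩
  tfae_have 1 ↔ 2 := abc.out 0 1
  tfae_have 1 ↔ 3 := abc.out 0 2
  tfae_have 1 → 4 := fun h =>
    ⟨fun V _ _ _ => h.isFinDimModule_of_isSimpleModule V, fun _ _ _ _ _ _ _ hM hi =>
      h.isLocallyFiniteModule_of_isNoetherianRing hi.isEssentialExtension_range <|
        hM.of_injective _ (LinearEquiv.ofInjective _ hi.injective).symm.injective⟩
  tfae_have 4 → 2 := fun ⟨hsimple, hhull⟩ V E _ _ _ _ i hV hi =>
    hhull V E i (hsimple V hV).isLocallyFiniteModule hi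
  tfae_have 4 → 5 := fun h => by
    obtain ⟨E, i, hi⟩ := exists_isInjectiveHull (A := A) (FiniteDual k A)
    have hE := h.2 _ E i FiniteDual.isLocallyFiniteModule hi
    have := FiniteDual.injective_of_embedding hi.injective_module hE i hi.injective
    exact ⟨Module.injective_object_of_injective_module A (FiniteDual k A),
      tfae_1_iff_3.1 (tfae_1_iff_2.2 (tfae_4_to_2 h))⟩
  tfae_have 5 → 3 := And.right
  tfae_finish
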